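/- Let $K$ and $H$ be complex Hilbert spaces of arbitrary dimension, and let $B(K)\otimes B(H)=B(K\otimes H)$ be the von Neumann algebra tensor product. A state or a positive linear map is called normal if it is weakly continuous on bounded sets. Let $\rho$ be a normal state on $B(K)\otimes B(H)$ with density operator $h$, that is, $h\ge 0$ is a trace class operator on $K\otimes H$ and $\rho(x)=\mathrm{Tr}(hx)$ for all $x\in B(K)\otimes B(H)$. Call $\rho$ separable if it belongs to the norm closure of the set of finite sums $\sum_i c_i\,\sigma_i\otimes\omega_i$ with $c_i\ge 0$, $\sigma_i$ a state of $B(K)$ and $\omega_i$ a normal state of $B(H)$; here $\sigma\otimes\omega=\sigma\circ(\iota\otimes\omega)$, where $\iota\otimes\omega\colon B(K\otimes H)\to B(K)$ is the slice map of $\omega$. For a positive linear map $\psi\colon B(H)\to B(K)$ let $(\iota\otimes\psi)(h)$ denote the unique bounded operator on $K\otimes K$ such that $$\langle k\otimes a,\ (\iota\otimes\psi)(h)\,(k'\otimes b)\rangle=\langle a,\ \psi(V_k^*hV_{k'})\,b\rangle\qquad (k,k',a,b\in K),$$ where $V_k\colon H\to K\otimes H$ is the operator $V_kx=k\otimes x$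 (such an operator exists because $h$ is positive and of trace class). Then $\rho$ is separable if and only if $(\iota\otimes\psi)(h)\ge 0$ for every normal positive linear map $\psi\colon B(H)\to B(K)$. -/

import Mathlib

open scoped TensorProduct InnerProductSpace ComplexOrder

namespace NormalStates

noncomputable section

universe u v w

/-- The Hilbert space tensor product: the completion of the algebraic tensor product with
`⟪k ⊗ x, k' ⊗ x'⟫ = ⟪k, k'⟫ ⟪x, x'⟫`. -/
abbrev HTensor (K : Type u) (H : Type v)
    [NormedAddCommGroup K] [InnerProductSpace ℂ K]
    [NormedAddCommGroup H] [InnerProductSpace ℂ H] : Type (max u v) :=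
  UniformSpace.Completion (K ⊗[ℂ] H)

/-- The von Neumann algebra `B(E)` of all bounded operators on `E`. The von Neumann algebra tensor
product `B(K) ⊗ B(H)` is `B(K ⊗ H)`, that is, `Bdd (HTensor K H)`. -/
abbrev Bdd (E : Type u) [NormedAddCommGroup E] [InnerProductSpace ℂ E] : Type u := E →L[ℂ] E

section trace

variable {E : Type u} [NormedAddCommGroup E] [InnerProductSpace ℂ E] [CompleteSpace E]

/-- `T` is trace class: `∑ᵢ ⟪bᵢ, |T| bᵢ⟫ < ∞` for every Hilbert basis `b`, where
`|T| = (T* T)^{1/2}`. -/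
def IsTraceClass (T : Bdd E) : Prop :=
  ∀ (ι : Type u) (b : HilbertBasis ι ℂ E), Summable fun i => (⟪b i, CFC.abs T (b i)⟫_ℂ).re

/-- `Tr T = c`: the series `∑ᵢ ⟪bᵢ, T bᵢ⟫` converges to `c` for every Hilbert basis `b`. -/
def HasTrace (T : Bdd E) (c : ℂ) : Prop :=
  ∀ (ι : Type u) (b : HilbertBasis ι ℂ E), HasSum (fun i => ⟪b i, T (b i)⟫_ℂ) c

/-- `ρ` is a state of `B(E)`: a positive linear functional with `ρ 1 = 1`. -/
def IsState (ρ : StrongDual ℂ (Bdd E)) : Prop :=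
  (∀ x : Bdd E, 0 ≤ x → 0 ≤ ρ x) ∧ ρ 1 = 1

/-- `ρ` is normal: it is weakly continuous (continuous for the weak operator topology) on bounded
sets. -/
def IsNormalFunctional (ρ : StrongDual ℂ (Bdd E)) : Prop :=
  ∀ S : Set (Bdd E), Bornology.IsBounded S →
    ContinuousOn (fun T : E →WOT[ℂ] E => ρ T.toCLM) {T | T.toCLM ∈ S}

/-- `h` is the density operator of `ρ`: a positive trace class operator with `ρ x = Tr (h x)` for
all `x`. -/
def IsDensityOperator (ρ : StrongDual ℂ (Bdd E)) (h : Bdd E) : Prop :=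
  0 ≤ h ∧ IsTraceClass h ∧ ∀ x : Bdd E, HasTrace (h * x) (ρ x)

end trace

section maps

variable {H : Type v} [NormedAddCommGroup H] [InnerProductSpace ℂ H] [CompleteSpace H]
variable {K : Type u} [NormedAddCommGroup K] [InnerProductSpace ℂ K] [CompleteSpace K]

/-- A positive linear map `B(H) → B(K)` is normal if it is weakly continuous (continuous for the weak
operator topologies) on bounded sets. -/
def IsNormalMap (ψ : Bdd H →ₚ[ℂ] Bdd K) : Prop :=
  ∀ S : Set (Bdd H), Bornology.IsBounded S →
    ContinuousOn (fun T : H →WOT[ℂ] H => ContinuousLinearMapWOT.ofCLM (ψ T.toCLM))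
      {T | T.toCLM ∈ S}

end maps

section slices

variable {K : Type u} [NormedAddCommGroup K] [InnerProductSpace ℂ K]
variable {H : Type v} [NormedAddCommGroup H] [InnerProductSpace ℂ H]

variable (H) in
/-- The operator `V_k : H → K ⊗ H`, `x ↦ k ⊗ x`. -/
def leg (k : K) : H →L[ℂ] HTensor K H :=
  UniformSpace.Completion.toComplL ∘L TensorProduct.mkL ℂ K H k

/-- The elementary tensor `k ⊗ x` as a vector of the Hilbert space `K ⊗ H`. -/
abbrev tmul (k : K) (x : H) : HTensor K H := leg H k x

lemma leg_add (k k' : K) : leg H (k + k') = leg H k + leg H k' := by simp [leg]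

lemma leg_smul (c : ℂ) (k : K) : leg H (c • k) = c • leg H k := by simp [leg]

@[simp] lemma norm_tmul (k : K) (x : H) : ‖leg H k x‖ = ‖k‖ * ‖x‖ := by
  simp [leg]

lemma norm_leg_le (k : K) : ‖leg H k‖ ≤ ‖k‖ :=
  ContinuousLinearMap.opNorm_le_bound _ (norm_nonneg _) fun x => (norm_tmul k x).le

lemma inner_tmul_tmul (k k' : K) (x x' : H) :
    ⟪leg H k x, leg H k' x'⟫_ℂ = ⟪k, k'⟫_ℂ * ⟪x, x'⟫_ℂ := by
  simp [leg]

/-- Two vectors of `K ⊗ H` with the same inner products with elementary tensors are equal. -/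
lemma ext_tmul {y z : HTensor K H} (h : ∀ k x, ⟪leg H k x, y⟫_ℂ = ⟪leg H k x, z⟫_ℂ) :
    y = z := by
  refine ext_inner_left ℂ fun w => ?_
  induction w using UniformSpace.Completion.induction_on with
  | hp => exact isClosed_eq (by fun_prop) (by fun_prop)
  | ih w =>
    induction w using TensorProduct.induction_on with
    | zero => rw [UniformSpace.Completion.coe_zero, inner_zero_left, inner_zero_left]
    | tmul k x => exact h k x
    | add a b ha hb =>
      rw [UniformSpace.Completion.coe_add, inner_add_left, inner_add_left, ha, hb]

/-- Two bounded operators out of `K ⊗ H` that agree on elementary tensors are equal. -/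
lemma clm_ext_tmul {F : Type w} [NormedAddCommGroup F] [NormedSpace ℂ F]
    {S T : HTensor K H →L[ℂ] F} (h : ∀ k x, S (leg H k x) = T (leg H k x)) : S = T := by
  ext y
  induction y using UniformSpace.Completion.induction_on with
  | hp => exact isClosed_eq (by fun_prop) (by fun_prop)
  | ih w =>
    induction w using TensorProduct.induction_on with
    | zero => rw [UniformSpace.Completion.coe_zero, map_zero, map_zero]
    | tmul k x => exact h k x
    | add a b ha hb => rw [UniformSpace.Completion.coe_add, map_add, map_add, ha, hb]

/-- `‖∑ᵢ eᵢ ⊗ aᵢ‖² = ∑ᵢ ‖aᵢ‖²` for orthonormal `e`. -/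
lemma norm_sum_leg_sq {n : ℕ} {e : Fin n → K} (he : Orthonormal ℂ e) (a : Fin n → H) :
    ‖∑ i, leg H (e i) (a i)‖ ^ 2 = ∑ i, ‖a i‖ ^ 2 := by
  have h : ⟪∑ i, leg H (e i) (a i), ∑ i, leg H (e i) (a i)⟫_ℂ =
      ((∑ i, ‖a i‖ ^ 2 : ℝ) : ℂ) := by
    rw [sum_inner, Complex.ofReal_sum]
    refine Finset.sum_congr rfl fun i _ => ?_
    rw [inner_sum, Finset.sum_eq_single i]
    · rw [inner_tmul_tmul, inner_self_eq_norm_sq_to_K, inner_self_eq_norm_sq_to_K, he.1 i]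
      simp
    · intro j _ hj
      rw [inner_tmul_tmul, he.2 hj.symm, zero_mul]
    · simp
  rw [inner_self_eq_norm_sq_to_K] at h
  exact Complex.ofReal_injective (by rw [← h]; norm_cast)

/-- Every algebraic tensor is `∑ᵢ eᵢ ⊗ aᵢ` with a finite orthonormal family `e`. -/
lemma exists_orthonormal_decomp (y : K ⊗[ℂ] H) :
    ∃ (n : ℕ) (e : Fin n → K) (a : Fin n → H), Orthonormal ℂ e ∧ y = ∑ i, e i ⊗ₜ[ℂ] a i := by
  obtain ⟨K', hK', hy⟩ :=
    TensorProduct.exists_finite_submodule_left_of_setFinite {y} (Set.finite_singleton y)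
  obtain ⟨y', rfl⟩ := Set.singleton_subset_iff.mp hy
  let b := stdOrthonormalBasis ℂ K'
  refine ⟨_, fun i => (b i : K), ?_⟩
  suffices ∃ a : Fin _ → H, (LinearMap.rTensor H K'.subtype) y' = ∑ i, (b i : K) ⊗ₜ[ℂ] a i by
    obtain ⟨a, ha⟩ := this
    exact ⟨a, b.orthonormal.comp_linearIsometry K'.subtypeₗᵢ, ha⟩
  induction y' using TensorProduct.induction_on with
  | zero => exact ⟨0, by simp⟩
  | tmul k x =>
    refine ⟨fun i => b.repr k i • x, ?_⟩
    conv_lhs => rw [← b.sum_repr k]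
    simp [TensorProduct.sum_tmul, TensorProduct.smul_tmul]
  | add p q hp hq =>
    obtain ⟨a, ha⟩ := hp (by simp)
    obtain ⟨c, hc⟩ := hq (by simp)
    exact ⟨a + c, by simp [ha, hc, TensorProduct.tmul_add, Finset.sum_add_distrib]⟩

variable [CompleteSpace H]

/-- The matrix block `V_k* x V_k' ∈ B(H)` of `x ∈ B(K ⊗ H)`, so that
`⟪a, block x k k' b⟫ = ⟪k ⊗ a, x (k' ⊗ b)⟫`. -/
def block (x : Bdd (HTensor K H)) (k k' : K) : Bdd H :=
  (ContinuousLinearMap.adjoint (leg H k)) ∘L x ∘L leg H k'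

lemma inner_block (x : Bdd (HTensor K H)) (k k' : K) (a b : H) :
    ⟪a, block x k k' b⟫_ℂ = ⟪tmul k a, x (tmul k' b)⟫_ℂ := by
  simp [block, ContinuousLinearMap.adjoint_inner_right]

lemma norm_block_le (x : Bdd (HTensor K H)) (k k' : K) :
    ‖block x k k'‖ ≤ ‖x‖ * ‖k‖ * ‖k'‖ := by
  calc ‖block x k k'‖ ≤ ‖ContinuousLinearMap.adjoint (leg H k)‖ * (‖x‖ * ‖leg H k'‖) :=
        (ContinuousLinearMap.opNorm_comp_le _ _).trans
          (mul_le_mul_of_nonneg_left (ContinuousLinearMap.opNorm_comp_le _ _) (norm_nonneg _))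
    _ ≤ ‖k‖ * (‖x‖ * ‖k'‖) := by
        rw [LinearIsometryEquiv.norm_map]
        gcongr <;> exact norm_leg_le _
    _ = ‖x‖ * ‖k‖ * ‖k'‖ := by ring

/-- `block x k k'`, which is conjugate linear in `k` and linear in `k'`. -/
def blockₛₗ (x : Bdd (HTensor K H)) : K →ₗ⋆[ℂ] K →ₗ[ℂ] Bdd H :=
  LinearMap.mk₂'ₛₗ _ _ (block x)
    (fun k₁ k₂ k' => by simp [block, leg_add, ContinuousLinearMap.add_comp])
    (fun c k k' => by
      rw [block, leg_smul, map_smulₛₗ, ContinuousLinearMap.smul_comp]; rfl)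
    (fun k k₁ k₂ => by simp [block, leg_add, ContinuousLinearMap.comp_add])
    (fun c k k' => by simp [block, leg_smul])

variable [CompleteSpace K]

/-- The bounded sesquilinear form `(k, k') ↦ ω (V_k* x V_k')` on `K`. -/
def sliceForm (ω : StrongDual ℂ (Bdd H)) (x : Bdd (HTensor K H)) : K →L⋆[ℂ] K →L[ℂ] ℂ :=
  LinearMap.mkContinuous₂ ((blockₛₗ x).compr₂ₛₗ ω.toLinearMap) (‖ω‖ * ‖x‖) (fun k k' => by
    calc ‖ω (block x k k')‖ ≤ ‖ω‖ * ‖block x k k'‖ := ω.le_opNorm _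
      _ ≤ ‖ω‖ * (‖x‖ * ‖k‖ * ‖k'‖) := by gcongr; exact norm_block_le _ _ _
      _ = ‖ω‖ * ‖x‖ * ‖k‖ * ‖k'‖ := by ring)

/-- The value `(ι ⊗ ω)(x) ∈ B(K)` of the slice map at `x ∈ B(K ⊗ H)`: the operator with
`⟪k, (ι ⊗ ω)(x) k'⟫ = ω (V_k* x V_k')`. -/
def sliceOp (ω : StrongDual ℂ (Bdd H)) (x : Bdd (HTensor K H)) : Bdd K :=
  ContinuousLinearMap.adjoint
    (InnerProductSpace.continuousLinearMapOfBilin (sliceForm ω x))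

lemma inner_sliceOp (ω : StrongDual ℂ (Bdd H)) (x : Bdd (HTensor K H)) (k k' : K) :
    ⟪k, sliceOp ω x k'⟫_ℂ = ω (block x k k') := by
  rw [sliceOp, ContinuousLinearMap.adjoint_inner_right,
    InnerProductSpace.continuousLinearMapOfBilin_apply]
  rfl

lemma norm_sliceOp_le (ω : StrongDual ℂ (Bdd H)) (x : Bdd (HTensor K H)) :
    ‖sliceOp ω x‖ ≤ ‖ω‖ * ‖x‖ := by
  refine ContinuousLinearMap.opNorm_le_bound _ (by positivity) fun k' => ?_
  have key : ‖sliceOp ω x k'‖ * ‖sliceOp ω x k'‖ ≤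
      (‖ω‖ * ‖x‖ * ‖k'‖) * ‖sliceOp ω x k'‖ := by
    calc ‖sliceOp ω x k'‖ * ‖sliceOp ω x k'‖ = ‖⟪sliceOp ω x k', sliceOp ω x k'⟫_ℂ‖ := by
          rw [inner_self_eq_norm_sq_to_K]; simp [sq]
      _ = ‖ω (block x (sliceOp ω x k') k')‖ := by rw [inner_sliceOp]
      _ ≤ ‖ω‖ * (‖x‖ * ‖sliceOp ω x k'‖ * ‖k'‖) :=
          (ω.le_opNorm _).trans (by gcongr; exact norm_block_le _ _ _)
      _ = _ := by ring
  rcases (norm_nonneg (sliceOp ω x k')).eq_or_lt with h0 | h0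
  · rw [← h0]; positivity
  · exact le_of_mul_le_mul_right key h0

/-- The slice map `ι ⊗ ω : B(K ⊗ H) → B(K)`. -/
def slice (ω : StrongDual ℂ (Bdd H)) : Bdd (HTensor K H) →L[ℂ] Bdd K :=
  LinearMap.mkContinuous
    { toFun := sliceOp ω
      map_add' := fun x y => by
        refine ContinuousLinearMap.ext fun k' => ext_inner_left ℂ fun k => ?_
        rw [add_apply, inner_add_right]
        simp only [inner_sliceOp]
        rw [← map_add]
        congr 1
        simp [block, ContinuousLinearMap.add_comp, ContinuousLinearMap.comp_add]
      map_smul' := fun c x => by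
        refine ContinuousLinearMap.ext fun k' => ext_inner_left ℂ fun k => ?_
        rw [smul_apply, inner_smul_right]
        simp only [inner_sliceOp, RingHom.id_apply]
        rw [← smul_eq_mul, ← map_smul]
        congr 1
        simp [block, ContinuousLinearMap.smul_comp] }
    ‖ω‖ (norm_sliceOp_le ω)

/-- The functional `σ ⊗ ω = σ ∘ (ι ⊗ ω)` on `B(K) ⊗ B(H)`. -/
def prodFunctional (σ : StrongDual ℂ (Bdd K)) (ω : StrongDual ℂ (Bdd H)) :
    StrongDual ℂ (Bdd (HTensor K H)) :=
  σ ∘L slice ω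

/-- The states `σ ⊗ ω` with `σ` a state of `B(K)` and `ω` a normal state of `B(H)`. -/
def productStates (K : Type u) (H : Type v)
    [NormedAddCommGroup K] [InnerProductSpace ℂ K] [CompleteSpace K]
    [NormedAddCommGroup H] [InnerProductSpace ℂ H] [CompleteSpace H] :
    Set (StrongDual ℂ (Bdd (HTensor K H))) :=
  {τ | ∃ (σ : StrongDual ℂ (Bdd K)) (ω : StrongDual ℂ (Bdd H)),
    IsState σ ∧ IsState ω ∧ IsNormalFunctional ω ∧ τ = prodFunctional σ ω}

/-- `ρ` is separable: it belongs to the norm closure of the set of positive sums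
`∑ᵢ cᵢ (σᵢ ⊗ ωᵢ)`, `cᵢ ≥ 0`, of product states. -/
def IsSeparable (ρ : StrongDual ℂ (Bdd (HTensor K H))) : Prop :=
  ρ ∈ closure {τ | ∃ (n : ℕ) (c : Fin n → ℝ) (p : Fin n → StrongDual ℂ (Bdd (HTensor K H))),
    (∀ i, 0 ≤ c i) ∧ (∀ i, p i ∈ productStates K H) ∧ τ = ∑ i, (c i : ℂ) • p i}

/-- `T = (ι ⊗ ψ)(h)`: `T` is the bounded operator on `K ⊗ K` with blocks
`V_k* T V_k' = ψ (V_k* h V_k')`. -/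
def IsAmpliation (ψ : Bdd H →ₚ[ℂ] Bdd K) (h : Bdd (HTensor K H)) (T : Bdd (HTensor K K)) : Prop :=
  ∀ k k' : K, block T k k' = ψ (block h k k')

lemma IsAmpliation.unique {ψ : Bdd H →ₚ[ℂ] Bdd K} {h : Bdd (HTensor K H)}
    {S T : Bdd (HTensor K K)} (hS : IsAmpliation ψ h S) (hT : IsAmpliation ψ h T) : S = T := by
  refine clm_ext_tmul fun k' b => ext_tmul fun k a => ?_
  rw [← inner_block, ← inner_block, hS, hT]

/-- Summed Bessel inequality: `∑ᵢ ‖V_{eᵢ}* y‖² ≤ ‖y‖²` for orthonormal `e`. -/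
lemma sum_norm_adjoint_leg_sq_le {n : ℕ} {e : Fin n → K} (he : Orthonormal ℂ e)
    (y : HTensor K H) :
    ∑ i, ‖ContinuousLinearMap.adjoint (leg H (e i)) y‖ ^ 2 ≤ ‖y‖ ^ 2 := by
  set a : Fin n → H := fun i => ContinuousLinearMap.adjoint (leg H (e i)) y with ha
  have hz : ‖∑ i, leg H (e i) (a i)‖ ^ 2 = ∑ i, ‖a i‖ ^ 2 := norm_sum_leg_sq he a
  have h1 : ⟪∑ i, leg H (e i) (a i), y⟫_ℂ = ((∑ i, ‖a i‖ ^ 2 : ℝ) : ℂ) := by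
    rw [sum_inner, Complex.ofReal_sum]
    refine Finset.sum_congr rfl fun i _ => ?_
    rw [← ContinuousLinearMap.adjoint_inner_right]
    change ⟪a i, a i⟫_ℂ = _
    rw [inner_self_eq_norm_sq_to_K]
    simp
  have h2 := norm_inner_le_norm (𝕜 := ℂ) (∑ i, leg H (e i) (a i)) y
  have h0 : 0 ≤ ∑ i, ‖a i‖ ^ 2 := Finset.sum_nonneg fun i _ => sq_nonneg _
  rw [h1, Complex.norm_real, Real.norm_of_nonneg h0] at h2
  rw [← hz] at h2 h0 ⊢
  nlinarith [norm_nonneg (∑ i, leg H (e i) (a i)), norm_nonneg y]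

/-- The square root of a positive operator. -/
lemma exists_sqrt {E : Type w} [NormedAddCommGroup E] [InnerProductSpace ℂ E] [CompleteSpace E]
    {h : Bdd E} (h0 : 0 ≤ h) : ∃ S : Bdd E, IsSelfAdjoint S ∧ S ∘L S = h :=
  ⟨CFC.sqrt h, (CFC.sqrt_nonneg h).isSelfAdjoint, CFC.sqrt_mul_sqrt_self h h0⟩

lemma exists_trace_bound {h S : Bdd (HTensor K H)} (h0 : 0 ≤ h) (hs : IsSelfAdjoint S)
    (hS : S ∘L S = h) (ht : IsTraceClass h) :
    ∃ M : ℝ, 0 ≤ M ∧ ∀ (n : ℕ) (e : Fin n → K), Orthonormal ℂ e →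
      ∑ i, ‖S ∘L leg H (e i)‖ ^ 2 ≤ M := by
  obtain ⟨w, b, -⟩ := exists_hilbertBasis ℂ (HTensor K H)
  have hadj : ∀ y z, ⟪y, S z⟫_ℂ = ⟪S y, z⟫_ℂ := fun y z => by
    rw [← ContinuousLinearMap.adjoint_inner_left, hs.adjoint_eq]
  have hsq : ∀ y, (⟪y, h y⟫_ℂ).re = ‖S y‖ ^ 2 := fun y => by
    rw [← hS, ContinuousLinearMap.comp_apply, hadj, inner_self_eq_norm_sq_to_K]
    norm_cast
  have hsum : Summable fun j => ‖S (b j)‖ ^ 2 := by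
    have := ht w b
    rw [CFC.abs_of_nonneg h h0] at this
    simpa only [hsq] using this
  refine ⟨∑' j, ‖S (b j)‖ ^ 2, tsum_nonneg fun j => sq_nonneg _, fun n e he => ?_⟩
  have hle : ∀ i, ∀ j, ‖ContinuousLinearMap.adjoint (leg H (e i)) (S (b j))‖ ^ 2 ≤
      ‖S (b j)‖ ^ 2 := fun i j =>
    (Finset.single_le_sum (f := fun i =>
      ‖ContinuousLinearMap.adjoint (leg H (e i)) (S (b j))‖ ^ 2)
      (fun i _ => sq_nonneg _) (Finset.mem_univ i)).trans
      (sum_norm_adjoint_leg_sq_le he (S (b j)))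
  have hsi : ∀ i, Summable fun j =>
      ‖ContinuousLinearMap.adjoint (leg H (e i)) (S (b j))‖ ^ 2 := fun i =>
    Summable.of_nonneg_of_le (fun j => sq_nonneg _) (hle i) hsum
  have hone : ∀ i, ‖S ∘L leg H (e i)‖ ^ 2 ≤
      ∑' j, ‖ContinuousLinearMap.adjoint (leg H (e i)) (S (b j))‖ ^ 2 := by
    intro i
    set A := ∑' j, ‖ContinuousLinearMap.adjoint (leg H (e i)) (S (b j))‖ ^ 2 with hA
    have hA0 : 0 ≤ A := tsum_nonneg fun j => sq_nonneg _
    rw [← Real.sqrt_le_sqrt_iff hA0, Real.sqrt_sq (norm_nonneg _)]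
    refine ContinuousLinearMap.opNorm_le_bound _ (Real.sqrt_nonneg _) fun v => ?_
    refine abs_le_of_sq_le_sq' ?_ (by positivity) |>.2
    rw [mul_pow, Real.sq_sqrt hA0]
    have hp : HasSum (fun j => ‖⟪b j, S (leg H (e i) v)⟫_ℂ‖ ^ 2)
        (‖S (leg H (e i) v)‖ ^ 2) := by
      have h1 := b.hasSum_inner_mul_inner (S (leg H (e i) v))
        (S (leg H (e i) v))
      rw [inner_self_eq_norm_sq_to_K] at h1
      have h2 := Complex.hasSum_re h1
      convert! h2 using 1
      · ext j
        rw [← inner_conj_symm (S (leg H (e i) v)) (b j), RCLike.conj_mul]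
        norm_cast
      · norm_cast
    refine hasSum_le (fun j => ?_) hp ((hsi i).hasSum.mul_right (‖v‖ ^ 2))
    rw [← mul_pow, hadj, ← ContinuousLinearMap.adjoint_inner_left]
    gcongr
    exact norm_inner_le_norm _ _
  calc ∑ i, ‖S ∘L leg H (e i)‖ ^ 2
      ≤ ∑ i, ∑' j, ‖ContinuousLinearMap.adjoint (leg H (e i)) (S (b j))‖ ^ 2 :=
        Finset.sum_le_sum fun i _ => hone i
    _ = ∑' j, ∑ i, ‖ContinuousLinearMap.adjoint (leg H (e i)) (S (b j))‖ ^ 2 :=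
        (Summable.tsum_finsetSum fun i _ => hsi i).symm
    _ ≤ ∑' j, ‖S (b j)‖ ^ 2 :=
        Summable.tsum_le_tsum (fun j => sum_norm_adjoint_leg_sq_le he _)
          (summable_sum fun i _ => hsi i) hsum

/-- The sesquilinear form `⟪k ⊗ a, (ι ⊗ ψ)(h) (k' ⊗ b)⟫ = ⟪a, ψ (V_k* h V_k') b⟫` on the
algebraic tensor product. -/
def amplForm (ψ : Bdd H →ₚ[ℂ] Bdd K) (h : Bdd (HTensor K H)) :
    (K ⊗[ℂ] K) →ₗ⋆[ℂ] (K ⊗[ℂ] K) →ₗ[ℂ] ℂ :=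
  TensorProduct.lift (LinearMap.mk₂'ₛₗ (starRingEnd ℂ) (starRingEnd ℂ)
    (fun k a => TensorProduct.lift (LinearMap.mk₂ ℂ
      (fun k' b => ⟪a, ψ (blockₛₗ h k k') b⟫_ℂ)
      (fun k₁ k₂ b => by simp only [map_add, add_apply, inner_add_right])
      (fun c k' b => by
        simp only [map_smul, smul_apply, inner_smul_right, smul_eq_mul])
      (fun k' b₁ b₂ => by simp only [map_add, inner_add_right])
      (fun c k' b => by simp only [map_smul, inner_smul_right, smul_eq_mul])))
    (fun k₁ k₂ a => TensorProduct.ext' fun k' b => by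
      simp)
    (fun c k a => TensorProduct.ext' fun k' b => by
      simp)
    (fun k a₁ a₂ => TensorProduct.ext' fun k' b => by
      simp)
    (fun c k a => TensorProduct.ext' fun k' b => by
      simp [mul_comm]))

lemma amplForm_tmul (ψ : Bdd H →ₚ[ℂ] Bdd K) (h : Bdd (HTensor K H)) (k k' a b : K) :
    amplForm ψ h (k ⊗ₜ a) (k' ⊗ₜ b) = ⟪a, ψ (block h k k') b⟫_ℂ := rfl

lemma exists_amplForm_bound (ψ : Bdd H →ₚ[ℂ] Bdd K) {h : Bdd (HTensor K H)} (h0 : 0 ≤ h)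
    (ht : IsTraceClass h) :
    ∃ C : ℝ, ∀ y z, ‖amplForm ψ h y z‖ ≤ C * ‖y‖ * ‖z‖ := by
  obtain ⟨S, hs, hS⟩ := exists_sqrt h0
  obtain ⟨M, hM0, hM⟩ := exists_trace_bound h0 hs hS ht
  obtain ⟨C, hC⟩ := ψ.exists_norm_apply_le
  have hblock : ∀ k k', ‖block h k k'‖ ≤
      ‖S ∘L leg H k‖ * ‖S ∘L leg H k'‖ := by
    intro k k'
    have : block h k k' = ContinuousLinearMap.adjoint (S ∘L leg H k) ∘L
        (S ∘L leg H k') := by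
      rw [ContinuousLinearMap.adjoint_comp, hs.adjoint_eq, block, ← hS]
      rfl
    rw [this]
    refine (ContinuousLinearMap.opNorm_comp_le _ _).trans ?_
    rw [LinearIsometryEquiv.norm_map]
  have hCS : ∀ (n : ℕ) (e : Fin n → K) (a : Fin n → K), Orthonormal ℂ e →
      ∑ i, ‖S ∘L leg H (e i)‖ * ‖a i‖ ≤
        √M * ‖∑ i, e i ⊗ₜ[ℂ] a i‖ := by
    intro n e a he
    refine (Real.sum_mul_le_sqrt_mul_sqrt _ _ _).trans ?_
    have : ‖∑ i, e i ⊗ₜ[ℂ] a i‖ = √(∑ i, ‖a i‖ ^ 2) := by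
      rw [← norm_sum_leg_sq he a, Real.sqrt_sq (norm_nonneg _),
        ← UniformSpace.Completion.norm_coe]
      congr 1
      exact map_sum (UniformSpace.Completion.toComplL (𝕜 := ℂ) (E := K ⊗[ℂ] K)) _ _
    rw [this]
    gcongr
    exact hM n e he
  refine ⟨C * M, fun y z => ?_⟩
  obtain ⟨n, e, a, he, rfl⟩ := exists_orthonormal_decomp y
  obtain ⟨m, f, b, hf, rfl⟩ := exists_orthonormal_decomp z
  have hexp : amplForm ψ h (∑ i, e i ⊗ₜ[ℂ] a i) (∑ j, f j ⊗ₜ[ℂ] b j) =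
      ∑ i, ∑ j, ⟪a i, ψ (block h (e i) (f j)) (b j)⟫_ℂ := by
    simp only [map_sum, LinearMap.sum_apply, amplForm_tmul]
    exact Finset.sum_comm
  rw [hexp]
  calc ‖∑ i, ∑ j, ⟪a i, ψ (block h (e i) (f j)) (b j)⟫_ℂ‖
      ≤ ∑ i, ∑ j, ‖⟪a i, ψ (block h (e i) (f j)) (b j)⟫_ℂ‖ :=
        (norm_sum_le _ _).trans (Finset.sum_le_sum fun i _ => norm_sum_le _ _)
    _ ≤ ∑ i, ∑ j, C * ((‖S ∘L leg H (e i)‖ * ‖a i‖) *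
          (‖S ∘L leg H (f j)‖ * ‖b j‖)) := by
        refine Finset.sum_le_sum fun i _ => Finset.sum_le_sum fun j _ => ?_
        calc ‖⟪a i, ψ (block h (e i) (f j)) (b j)⟫_ℂ‖
            ≤ ‖a i‖ * (‖ψ (block h (e i) (f j))‖ * ‖b j‖) :=
              (norm_inner_le_norm _ _).trans (by gcongr; exact ContinuousLinearMap.le_opNorm _ _)
          _ ≤ ‖a i‖ * ((C * (‖S ∘L leg H (e i)‖ * ‖S ∘L leg H (f j)‖))
                * ‖b j‖) := by
              gcongr
              exact (hC _).trans (by gcongr; exact hblock _ _)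
          _ = _ := by ring
    _ = C * ((∑ i, ‖S ∘L leg H (e i)‖ * ‖a i‖) *
          (∑ j, ‖S ∘L leg H (f j)‖ * ‖b j‖)) := by
        rw [Finset.sum_mul_sum, Finset.mul_sum]
        simp only [Finset.mul_sum]
    _ ≤ C * ((√M * ‖∑ i, e i ⊗ₜ[ℂ] a i‖) * (√M * ‖∑ j, f j ⊗ₜ[ℂ] b j‖)) := by
        gcongr
        · exact hCS n e a he
        · exact hCS m f b hf
    _ = C * (√M * √M) * ‖∑ i, e i ⊗ₜ[ℂ] a i‖ * ‖∑ j, f j ⊗ₜ[ℂ] b j‖ := by ring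
    _ = _ := by rw [Real.mul_self_sqrt hM0]

/-- `(ι ⊗ ψ)(h)` exists as a bounded operator for `h` positive and trace class. -/
theorem exists_isAmpliation (ψ : Bdd H →ₚ[ℂ] Bdd K) {h : Bdd (HTensor K H)} (h0 : 0 ≤ h)
    (ht : IsTraceClass h) : ∃ T, IsAmpliation ψ h T := by
  obtain ⟨C, hC⟩ := exists_amplForm_bound ψ h0 ht
  let B := (amplForm ψ h).mkContinuous₂ C hC
  let e : (K ⊗[ℂ] K) →L[ℂ] HTensor K K := UniformSpace.Completion.toComplL
  have hd : DenseRange e := UniformSpace.Completion.denseRange_coe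
  have hu : IsUniformInducing e := UniformSpace.Completion.isUniformInducing_coe _
  let Ψ : StrongDual ℂ (K ⊗[ℂ] K) →L[ℂ] StrongDual ℂ (HTensor K K) :=
    LinearMap.mkContinuous
      { toFun := fun f : StrongDual ℂ (K ⊗[ℂ] K) => ContinuousLinearMap.extend f e
        map_add' := fun f g => ContinuousLinearMap.extend_unique _ hd hu _ (by
          ext y
          simp only [ContinuousLinearMap.comp_apply, add_apply,
            ContinuousLinearMap.extend_eq _ hd hu])
        map_smul' := fun c f => ContinuousLinearMap.extend_unique _ hd hu _ (by
          ext y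
          simp only [ContinuousLinearMap.comp_apply, smul_apply,
            ContinuousLinearMap.extend_eq _ hd hu, RingHom.id_apply]) }
      1 (fun f => by
        have := ContinuousLinearMap.opNorm_extend_le f (e := e) (N := 1) hd (fun x => by simp [e])
        simpa using this)
  let B' : HTensor K K →L⋆[ℂ] HTensor K K →L[ℂ] ℂ :=
    (Ψ.comp B).extend e
  refine ⟨ContinuousLinearMap.adjoint (InnerProductSpace.continuousLinearMapOfBilin B'),
    fun k k' => ContinuousLinearMap.ext fun b => ext_inner_left ℂ fun a => ?_⟩
  rw [inner_block, ContinuousLinearMap.adjoint_inner_right,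
    InnerProductSpace.continuousLinearMapOfBilin_apply]
  change B' (e (k ⊗ₜ a)) (e (k' ⊗ₜ b)) = _
  rw [show B' (e (k ⊗ₜ a)) = (Ψ.comp B) (k ⊗ₜ a) from
    ContinuousLinearMap.extend_eq _ hd hu _]
  change (B (k ⊗ₜ a)).extend e (e (k' ⊗ₜ b)) = _
  rw [ContinuousLinearMap.extend_eq _ hd hu]
  rfl

open Classical in
/-- The operator `(ι ⊗ ψ)(h) ∈ B(K ⊗ K)`. It exists and is unique for `h` positive and trace class
(`isAmpliation_ampliation`, `IsAmpliation.unique`); the value `0` is used where there is none. -/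
def ampliation (ψ : Bdd H →ₚ[ℂ] Bdd K) (h : Bdd (HTensor K H)) : Bdd (HTensor K K) :=
  if hT : ∃ T, IsAmpliation ψ h T then hT.choose else 0

theorem isAmpliation_ampliation (ψ : Bdd H →ₚ[ℂ] Bdd K) {h : Bdd (HTensor K H)} (h0 : 0 ≤ h)
    (ht : IsTraceClass h) : IsAmpliation ψ h (ampliation ψ h) := by
  have hT := exists_isAmpliation ψ h0 ht
  rw [ampliation, dif_pos hT]
  exact hT.choose_spec

end slices

end

end NormalStates

/-! Both directions pair the matrix of `h` with a form that is nonnegative on product vectors. This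
is the duality between such forms and positive maps, read through finite blocks so that infinite
dimension causes no trouble. Necessity: on a finite sum `∑ eᵢ ⊗ aᵢ` the quadratic form of `(ι ⊗
ψ)(h)` is, by normality of `ψ`, the limit of `ρ (testOp ψ e a c t)` along finite sets `t`. Slicing
`testOp` by a state `ω` applies `ψ` to a single positive operator, so product states are nonnegative
on it (`prodFunctional_testOp_nonneg`), and this passes to the closed cone. Sufficiency: if `ρ` is
not separable, Hahn-Banach gives `f` in the bidual with `Re f ≥ 0` on product functionals and `Re f
ρ < 0` (`exists_separating`). Compressions of `ρ` to finite product blocks converge to `ρ` in norm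
(`tendsto_compress`), so `Re f` is already negative on one of them. On that block the hermitian form
of `f` is the Choi matrix of a finite rank normal map, which is positive because the form is
nonnegative on product vectors (`choiMap_nonneg`). Its ampliation, evaluated at `∑ bᵢ ⊗ bᵢ`, equals
twice that negative number. -/

namespace NormalStates

open Filter Topology InnerProductSpace

/-! ### Finite projections, vector functionals and estimates for states. -/

section operators

variable {E : Type*} [NormedAddCommGroup E] [InnerProductSpace ℂ E]

/-- An operator on a complex Hilbert space is positive as soon as its quadratic form is. -/
lemma nonneg_of_inner_nonneg [CompleteSpace E] {T : Bdd E} (hT : ∀ x, 0 ≤ ⟪x, T x⟫_ℂ) : 0 ≤ T := by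
  rw [ContinuousLinearMap.nonneg_iff_isPositive, ContinuousLinearMap.isPositive_iff_complex]
  intro x
  have h1 := hT x
  rw [← inner_conj_symm] at h1
  have h2 : 0 ≤ ⟪T x, x⟫_ℂ := by simpa using star_nonneg_iff.mp h1
  obtain ⟨h3, h4⟩ := RCLike.nonneg_iff.mp h2
  exact ⟨Complex.ext (by simp) (by simpa using h4.symm), h3⟩

lemma inner_nonneg_of_nonneg [CompleteSpace E] {T : Bdd E} (hT : 0 ≤ T) (x : E) :
    0 ≤ ⟪x, T x⟫_ℂ :=
  ((ContinuousLinearMap.nonneg_iff_isPositive T).mp hT).inner_nonneg_right x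

/-- The projection onto the span of the vectors `b i`, `i ∈ s`, of an orthonormal family `b`. -/
noncomputable def finProj {ι : Type*} (b : ι → E) (s : Finset ι) : Bdd E :=
  ∑ i ∈ s, rankOne ℂ (b i) (b i)

lemma finProj_apply {ι : Type*} (b : ι → E) (s : Finset ι) (x : E) :
    finProj b s x = ∑ i ∈ s, ⟪b i, x⟫_ℂ • b i := by
  simp [finProj]

lemma isStarProjection_finProj [CompleteSpace E] {ι : Type*} {b : ι → E} (hb : Orthonormal ℂ b)
    (s : Finset ι) : IsStarProjection (finProj b s) := by
  classical
  constructor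
  · refine ContinuousLinearMap.ext fun x => ?_
    rw [mul_apply_eq_comp, finProj_apply, finProj_apply]
    refine Finset.sum_congr rfl fun i hi => ?_
    rw [hb.inner_right_sum _ hi]
  · rw [finProj, IsSelfAdjoint, star_sum]
    simp [ContinuousLinearMap.star_eq_adjoint]

lemma tendsto_finProj_apply {ι : Type*} (b : HilbertBasis ι ℂ E) (x : E) :
    Tendsto (fun s => finProj b s x) atTop (𝓝 x) := by
  simpa only [finProj_apply, HilbertBasis.repr_apply_apply, HasSum,
    SummationFilter.unconditional_filter] using b.hasSum_repr x

lemma finProj_mul_mul_finProj {ι : Type*} (b : ι → E) (s : Finset ι) (x : Bdd E) :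
    finProj b s * x * finProj b s =
      ∑ i ∈ s, ∑ j ∈ s, ⟪b i, x (b j)⟫_ℂ • rankOne ℂ (b i) (b j) := by
  refine ContinuousLinearMap.ext fun v => ?_
  rw [mul_apply_eq_comp, mul_apply_eq_comp, finProj_apply, finProj_apply]
  simp only [map_sum, map_smul, inner_sum, inner_smul_right, sum_apply,
    smul_apply, rankOne_apply, Finset.sum_smul, smul_smul]
  exact Finset.sum_congr rfl fun i _ => Finset.sum_congr rfl fun j _ => by rw [mul_comm]

/-- `Q x Q → x` in the weak operator topology along the projections of a Hilbert basis. -/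
lemma tendsto_finProj_mul_mul_finProj [CompleteSpace E] {ι : Type*} (b : HilbertBasis ι ℂ E)
    (x : Bdd E) :
    Tendsto (fun s => ContinuousLinearMapWOT.ofCLM (finProj b s * x * finProj b s)) atTop
      (𝓝 (ContinuousLinearMapWOT.ofCLM x)) := by
  rw [ContinuousLinearMapWOT.tendsto_iff_forall_dual_apply_tendsto]
  intro v f
  obtain ⟨u, rfl⟩ := (toDual ℂ E).surjective f
  -- Moving the left projection onto `u` leaves norm convergence in both arguments of the inner
  -- product.
  have key : ∀ s, ⟪u, (finProj b s * x * finProj b s) v⟫_ℂ =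
      ⟪finProj b s u, x (finProj b s v)⟫_ℂ := fun s => by
    rw [← ContinuousLinearMap.adjoint_inner_right,
      (isStarProjection_finProj b.orthonormal s).isSelfAdjoint.adjoint_eq]
    rfl
  change Tendsto (fun s => ⟪u, (finProj b s * x * finProj b s) v⟫_ℂ) atTop (𝓝 ⟪u, x v⟫_ℂ)
  simp only [key]
  exact (tendsto_finProj_apply b u).inner
    ((x.continuous.tendsto v).comp (tendsto_finProj_apply b v))

/-- The functional `x ↦ ⟪u, x v⟫`. -/
noncomputable def vecFun (u v : E) : StrongDual ℂ (Bdd E) :=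
  (innerSL ℂ u) ∘L (ContinuousLinearMap.apply ℂ E v)

@[simp] lemma vecFun_apply (u v : E) (x : Bdd E) : vecFun u v x = ⟪u, x v⟫_ℂ := rfl

lemma isState_vecFun [CompleteSpace E] {u : E} (hu : ‖u‖ = 1) : IsState (vecFun u u) :=
  ⟨fun _ hx => inner_nonneg_of_nonneg hx u, by simp [inner_self_eq_norm_sq_to_K, hu]⟩

lemma isNormalFunctional_vecFun [CompleteSpace E] (u v : E) : IsNormalFunctional (vecFun u v) :=
  fun _ _ => (ContinuousLinearMapWOT.continuous_dual_apply v (innerSL ℂ u)).continuousOn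

section state

variable [CompleteSpace E] {ρ : StrongDual ℂ (Bdd E)}

/-- The positive linear map underlying a state. -/
noncomputable def IsState.toPositive (hρ : IsState ρ) : Bdd E →ₚ[ℂ] ℂ :=
  PositiveLinearMap.mk₀ ρ.toLinearMap hρ.1

lemma IsState.map_star (hρ : IsState ρ) (x : Bdd E) : ρ (star x) = star (ρ x) :=
  StarHomClass.map_star hρ.toPositive x

/-- The Cauchy-Schwarz inequality for states. -/
lemma IsState.norm_apply_star_mul_sq_le (hρ : IsState ρ) (x y : Bdd E) :
    ‖ρ (star x * y)‖ ^ 2 ≤ (ρ (star x * x)).re * (ρ (star y * y)).re := by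
  let f := hρ.toPositive
  -- In the GNS pre-Hilbert space the inner product of `x` and `y` is `ρ (star x * y)`.
  have h := norm_inner_le_norm (𝕜 := ℂ) (f.toPreGNS x) (f.toPreGNS y)
  have hx := f.preGNS_norm_sq (f.toPreGNS x)
  have hy := f.preGNS_norm_sq (f.toPreGNS y)
  have h2 := pow_le_pow_left₀ (norm_nonneg _) h 2
  rw [mul_pow] at h2
  have hx' : (ρ (star x * x)).re = ‖f.toPreGNS x‖ ^ 2 := by
    have : ((‖f.toPreGNS x‖ ^ 2 : ℝ) : ℂ) = ρ (star x * x) := by push_cast; exact hx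
    rw [← this, Complex.ofReal_re]
  have hy' : (ρ (star y * y)).re = ‖f.toPreGNS y‖ ^ 2 := by
    have : ((‖f.toPreGNS y‖ ^ 2 : ℝ) : ℂ) = ρ (star y * y) := by push_cast; exact hy
    rw [← this, Complex.ofReal_re]
  rw [hx', hy']
  exact h2

lemma IsState.re_apply_star_mul_self_le (hρ : IsState ρ) (x : Bdd E) :
    (ρ (star x * x)).re ≤ ‖x‖ ^ 2 := by
  have h1 : 0 ≤ ρ (algebraMap ℝ (Bdd E) (‖star x * x‖) - star x * x) := hρ.1 _ (by
    rw [sub_nonneg]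
    exact IsSelfAdjoint.le_algebraMap_norm_self (.star_mul_self x))
  have h2 : ρ (algebraMap ℝ (Bdd E) (‖star x * x‖)) = ((‖x‖ ^ 2 : ℝ) : ℂ) := by
    rw [CStarRing.norm_star_mul_self, Algebra.algebraMap_eq_smul_one, ← sq,
      ← Complex.coe_smul, map_smul, hρ.2]
    simp
  rw [map_sub, h2] at h1
  have := (Complex.le_def.mp h1).1
  rw [Complex.sub_re, Complex.ofReal_re] at this
  simpa using this

/-- The gentle measurement estimate: `‖ρ - ρ (R · R)‖ ≤ 2 ρ(1 - R)^{1/2}`. -/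
lemma IsState.norm_apply_sub_le (hρ : IsState ρ) {R : Bdd E} (hR : IsStarProjection R)
    (x : Bdd E) : ‖ρ x - ρ (R * x * R)‖ ≤ 2 * √(1 - (ρ R).re) * ‖x‖ := by
  have hR1 := hR.one_sub
  have hsq : ∀ {P : Bdd E}, IsStarProjection P → star P * P = P := fun hP => by
    rw [hP.isSelfAdjoint.star_eq, hP.isIdempotentElem.eq]
  have hre : (ρ (1 - R)).re = 1 - (ρ R).re := by rw [map_sub, hρ.2]; simp
  have hre0 : 0 ≤ 1 - (ρ R).re := hre ▸ (Complex.le_def.mp (hρ.1 _ hR1.nonneg)).1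
  -- Each summand has `1 - R` at one end, so Cauchy-Schwarz extracts a factor `ρ(1 - R)^{1/2}` from
  -- each; this is the source of the constant 2.
  have e1 : x - R * x * R = star (1 - R) * x + star (star (R * x)) * (1 - R) := by
    rw [hR1.isSelfAdjoint.star_eq, star_star]
    noncomm_ring
  have b1 : ‖ρ (star (1 - R) * x)‖ ≤ √(1 - (ρ R).re) * ‖x‖ := by
    refine abs_le_of_sq_le_sq' ?_ (by positivity) |>.2
    rw [mul_pow, Real.sq_sqrt hre0]
    refine (hρ.norm_apply_star_mul_sq_le _ _).trans ?_
    rw [hsq hR1, hre]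
    gcongr
    exact hρ.re_apply_star_mul_self_le x
  have b2 : ‖ρ (star (star (R * x)) * (1 - R))‖ ≤ √(1 - (ρ R).re) * ‖x‖ := by
    refine abs_le_of_sq_le_sq' ?_ (by positivity) |>.2
    rw [mul_pow, Real.sq_sqrt hre0, mul_comm]
    refine (hρ.norm_apply_star_mul_sq_le _ _).trans ?_
    rw [hsq hR1, hre]
    gcongr
    refine (hρ.re_apply_star_mul_self_le _).trans ?_
    gcongr
    rw [norm_star]
    refine (norm_mul_le _ _).trans ?_
    exact mul_le_of_le_one_left (norm_nonneg _) (hR.norm_le)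
  rw [← map_sub, e1, map_add]
  calc _ ≤ _ := norm_add_le _ _
    _ ≤ _ := add_le_add b1 b2
    _ = _ := by ring

end state

end operators

/-! ### Norm approximation of a state with a density operator by its compressions. -/

section density

universe u

variable {E : Type u} [NormedAddCommGroup E] [InnerProductSpace ℂ E] [CompleteSpace E]
  {ρ : StrongDual ℂ (Bdd E)} {h : Bdd E}

/-- Parseval's identity evaluates the trace of `h |u⟩⟨v|`. Note the reversed order of `u` and `v`,
which dictates the index order in `testOp` and `choiMap`. -/
lemma IsDensityOperator.apply_rankOne (hh : IsDensityOperator ρ h) (u v : E) :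
    ρ (rankOne ℂ u v) = ⟪v, h u⟫_ℂ := by
  obtain ⟨w, b, -⟩ := exists_hilbertBasis ℂ E
  refine (hh.2.2 (rankOne ℂ u v) w b).unique ?_
  have key : ∀ i, ⟪b i, (h * rankOne ℂ u v) (b i)⟫_ℂ = ⟪v, b i⟫_ℂ * ⟪b i, h u⟫_ℂ := fun i => by
    rw [mul_apply_eq_comp, rankOne_apply, map_smul, inner_smul_right]
  simpa only [key] using b.hasSum_inner_mul_inner v (h u)

/-- The compression `ρ (R · R)` of `ρ` to the span of the vectors `b i`, `i ∈ s`. -/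
noncomputable def compress {ι : Type*} (ρ : StrongDual ℂ (Bdd E)) (b : ι → E) (s : Finset ι) :
    StrongDual ℂ (Bdd E) :=
  ∑ i ∈ s, ∑ j ∈ s, ρ (rankOne ℂ (b i) (b j)) • vecFun (b i) (b j)

omit [CompleteSpace E] in
lemma compress_apply {ι : Type*} (b : ι → E) (s : Finset ι) (x : Bdd E) :
    compress ρ b s x = ρ (finProj b s * x * finProj b s) := by
  simp [compress, finProj_mul_mul_finProj, mul_comm]

/-- The trace formula at `x = 1`: the partial sums of `∑ ⟪bᵢ, h bᵢ⟫` are the values of `ρ` on the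
projections. With the gentle measurement estimate this yields convergence in norm, not merely
weakly. -/
lemma tendsto_apply_finProj {ι : Type u} (hh : IsDensityOperator ρ h) (b : HilbertBasis ι ℂ E) :
    Tendsto (fun s => ρ (finProj b s)) atTop (𝓝 (ρ 1)) := by
  have := hh.2.2 1 ι b
  simpa only [finProj, map_sum, hh.apply_rankOne, mul_one, HasSum,
    SummationFilter.unconditional_filter] using this

/-- A state with a density operator is the norm limit of its compressions. -/
lemma tendsto_compress {ι : Type u} (hρ : IsState ρ) (hh : IsDensityOperator ρ h)
    (b : HilbertBasis ι ℂ E) : Tendsto (compress ρ b) atTop (𝓝 ρ) := by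
  rw [tendsto_iff_norm_sub_tendsto_zero]
  have h1 : Tendsto (fun s => 2 * √(1 - (ρ (finProj b s)).re)) atTop (𝓝 0) := by
    have h2 := (Complex.continuous_re.tendsto _).comp (tendsto_apply_finProj hh b)
    rw [hρ.2] at h2
    have h3 := ((tendsto_const_nhds (x := (1 : ℝ))).sub h2).sqrt.const_mul 2
    simpa using h3
  refine squeeze_zero (fun _ => norm_nonneg _) (fun s => ?_) h1
  refine ContinuousLinearMap.opNorm_le_bound _ (by positivity) fun x => ?_
  rw [sub_apply, compress_apply, norm_sub_rev]
  exact hρ.norm_apply_sub_le (isStarProjection_finProj b.orthonormal s) x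

end density

/-! ### Product bases, slices of rank one operators, and positivity on separable functionals. -/

section tensor

variable {K : Type*} [NormedAddCommGroup K] [InnerProductSpace ℂ K]
  {H : Type*} [NormedAddCommGroup H] [InnerProductSpace ℂ H]

lemma orthonormal_tmul {ι κ : Type*} {e : ι → K} {c : κ → H} (he : Orthonormal ℂ e)
    (hc : Orthonormal ℂ c) : Orthonormal ℂ fun α : ι × κ => tmul (e α.1) (c α.2) := by
  classical
  rw [orthonormal_iff_ite] at he hc ⊢
  rintro ⟨i, p⟩ ⟨j, q⟩
  simp only [inner_tmul_tmul, he, hc, Prod.mk.injEq, ← ite_and, mul_ite, mul_one, mul_zero,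
    and_comm]

/-- The Hilbert basis `bᵢ ⊗ cₚ` of `K ⊗ H`. -/
noncomputable def prodBasis [CompleteSpace H] {ι κ : Type*} (b : HilbertBasis ι ℂ K)
    (c : HilbertBasis κ ℂ H) : HilbertBasis (ι × κ) ℂ (HTensor K H) :=
  HilbertBasis.mkOfOrthogonalEqBot (orthonormal_tmul b.orthonormal c.orthonormal) (by
    rw [Submodule.eq_bot_iff]
    intro y hy
    have h0 : ∀ i p, ⟪leg H (b i) (c p), y⟫_ℂ = 0 := fun i p =>
      Submodule.inner_right_of_mem_orthogonal (Submodule.subset_span (Set.mem_range_self (i, p))) hy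
    -- Totality is proved one factor at a time: expand `x` in `c` with `b i` fixed, then `k` in `b`
    -- with `x` fixed.
    have h1 : ∀ i x, ⟪y, leg H (b i) x⟫_ℂ = 0 := fun i x => by
      refine ((c.hasSum_repr x).mapL (innerSL ℂ y ∘L leg H (b i))).unique ?_
      convert hasSum_zero using 2 with p
      rw [map_smul, ContinuousLinearMap.comp_apply, innerSL_apply_apply, ← inner_conj_symm, h0,
        map_zero, smul_zero]
    refine ext_tmul fun k x => ?_
    rw [inner_zero_right]
    have h2 : innerSL ℂ y (leg H k x) = 0 := by
      have hf : HasSum (fun i => b.repr k i • innerSL ℂ y (leg H (b i) x))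
          (innerSL ℂ y (leg H k x)) := by
        let L : K →L[ℂ] HTensor K H :=
          UniformSpace.Completion.toComplL ∘L (TensorProduct.mkL ℂ K H).flip x
        simpa [L, leg] using (b.hasSum_repr k).mapL (innerSL ℂ y ∘L L)
      refine hf.unique ?_
      convert hasSum_zero using 2 with i
      rw [innerSL_apply_apply, h1, smul_zero]
    rw [← inner_conj_symm]
    exact (congrArg _ h2).trans (map_zero _))

@[simp] lemma prodBasis_apply [CompleteSpace H] {ι κ : Type*} (b : HilbertBasis ι ℂ K)
    (c : HilbertBasis κ ℂ H) (α : ι × κ) : prodBasis b c α = tmul (b α.1) (c α.2) := by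
  simp [prodBasis]

variable [CompleteSpace H]

lemma block_rankOne (k k' u v : K) (x x' : H) :
    block (rankOne ℂ (tmul k x) (tmul k' x')) u v =
      (⟪u, k⟫_ℂ * ⟪k', v⟫_ℂ) • rankOne ℂ x x' := by
  refine ContinuousLinearMap.ext fun b => ext_inner_left ℂ fun a => ?_
  rw [inner_block]
  simp only [rankOne_apply, inner_smul_right, inner_tmul_tmul, smul_apply]
  ring

variable [CompleteSpace K]

lemma inner_slice (ω : StrongDual ℂ (Bdd H)) (x : Bdd (HTensor K H)) (k k' : K) :
    ⟪k, slice ω x k'⟫_ℂ = ω (block x k k') :=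
  inner_sliceOp ω x k k'

lemma slice_rankOne (ω : StrongDual ℂ (Bdd H)) (k k' : K) (x x' : H) :
    slice ω (rankOne ℂ (tmul k x) (tmul k' x')) = ω (rankOne ℂ x x') • rankOne ℂ k k' := by
  refine ContinuousLinearMap.ext fun b => ext_inner_left ℂ fun a => ?_
  rw [inner_slice, block_rankOne]
  simp only [map_smul, smul_apply, rankOne_apply, inner_smul_right, smul_eq_mul]
  ring

lemma prodFunctional_vecFun (k : K) (x : H) :
    prodFunctional (vecFun k k) (vecFun x x) = vecFun (tmul k x) (tmul k x) := by
  ext T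
  change ⟪k, slice (vecFun x x) T k⟫_ℂ = _
  rw [inner_slice, vecFun_apply, inner_block, vecFun_apply]

/-- The operators on which all product states are nonnegative are nonnegative in all separable
states. -/
lemma IsSeparable.apply_nonneg {ρ : StrongDual ℂ (Bdd (HTensor K H))} (hs : IsSeparable ρ)
    {X : Bdd (HTensor K H)} (hX : ∀ τ ∈ productStates K H, 0 ≤ τ X) : 0 ≤ ρ X := by
  have hc : IsClosed {τ : StrongDual ℂ (Bdd (HTensor K H)) | 0 ≤ τ X} :=
    isClosed_le continuous_const (ContinuousLinearMap.apply ℂ ℂ X).continuous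
  refine closure_minimal ?_ hc hs
  rintro _ ⟨n, c, p, hc0, hp, rfl⟩
  simp only [Set.mem_ofPred_eq, sum_apply, smul_apply]
  exact Finset.sum_nonneg fun i _ =>
    mul_nonneg (Complex.zero_le_real.mpr (hc0 i)) (hX _ (hp i))

end tensor

/-! ### Separability implies positivity of all ampliations. -/

section necessity

variable {K : Type*} [NormedAddCommGroup K] [InnerProductSpace ℂ K] [CompleteSpace K]
  {H : Type*} [NormedAddCommGroup H] [InnerProductSpace ℂ H] [CompleteSpace H]

/-- For a positive operator `P` the operator `∑ᵢⱼ ⟪aᵢ, P aⱼ⟫ |eⱼ⟩⟨eᵢ|` is positive. -/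
lemma sum_inner_smul_rankOne_nonneg {E : Type*} [NormedAddCommGroup E] [InnerProductSpace ℂ E]
    [CompleteSpace E] {n : ℕ} (e : Fin n → K) (a : Fin n → E) {P : Bdd E} (hP : 0 ≤ P) :
    0 ≤ ∑ i, ∑ j, ⟪a i, P (a j)⟫_ℂ • rankOne ℂ (e j) (e i) := by
  refine nonneg_of_inner_nonneg fun v => ?_
  -- The transposed indices in `rankOne` turn the quadratic form at `v` into that of `P` at `∑ ⟪v,
  -- eᵢ⟫ aᵢ`.
  have key : ⟪v, (∑ i, ∑ j, ⟪a i, P (a j)⟫_ℂ • rankOne ℂ (e j) (e i)) v⟫_ℂ =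
      ⟪∑ i, ⟪v, e i⟫_ℂ • a i, P (∑ j, ⟪v, e j⟫_ℂ • a j)⟫_ℂ := by
    simp only [sum_apply, smul_apply, rankOne_apply, inner_sum, sum_inner, map_sum, map_smul,
      inner_smul_left, inner_smul_right, inner_conj_symm, Finset.mul_sum]
    rw [Finset.sum_comm]
    exact Finset.sum_congr rfl fun i _ => Finset.sum_congr rfl fun j _ => by ring
  rw [key]
  exact inner_nonneg_of_nonneg hP _

/-- For a positive functional `ω` the operator `∑ ω (|c_q⟩⟨c_p|) |c_p⟩⟨c_q|` is positive. -/
lemma sum_state_smul_rankOne_nonneg {ω : StrongDual ℂ (Bdd H)} (hω : IsState ω) {κ : Type*}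
    (c : κ → H) (t : Finset κ) :
    0 ≤ ∑ p ∈ t, ∑ q ∈ t, ω (rankOne ℂ (c q) (c p)) • rankOne ℂ (c p) (c q) := by
  refine nonneg_of_inner_nonneg fun v => ?_
  -- The quadratic form at `v` is `ω` of `|w⟩⟨w|` with `w = finProj c t v`.
  have key : ⟪v, (∑ p ∈ t, ∑ q ∈ t, ω (rankOne ℂ (c q) (c p)) • rankOne ℂ (c p) (c q)) v⟫_ℂ =
      ω (rankOne ℂ (∑ q ∈ t, ⟪c q, v⟫_ℂ • c q) (∑ p ∈ t, ⟪c p, v⟫_ℂ • c p)) := by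
    simp only [sum_apply, smul_apply, rankOne_apply, inner_sum, map_sum, map_smul, map_smulₛₗ,
      inner_smul_right, inner_conj_symm, smul_eq_mul, Finset.mul_sum]
    exact Finset.sum_congr rfl fun i _ => Finset.sum_congr rfl fun j _ => by ring
  rw [key]
  exact hω.1 _ ((ContinuousLinearMap.nonneg_iff_isPositive _).mpr (isPositive_rankOne_self _))

/-- The finite rank operator `X` with `ρ X = ∑ᵢⱼ ⟪aᵢ, ψ (Q V_{eᵢ}* h V_{eⱼ} Q) aⱼ⟫`, where `h` is the
density operator of `ρ` and `Q` is the projection onto the span of the vectors `cₚ`, `p ∈ t`. -/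
noncomputable def testOp (ψ : Bdd H →ₚ[ℂ] Bdd K) {n : ℕ} (e a : Fin n → K) {κ : Type*}
    (c : κ → H) (t : Finset κ) : Bdd (HTensor K H) :=
  ∑ i, ∑ j, ∑ p ∈ t, ∑ q ∈ t, ⟪a i, ψ (rankOne ℂ (c p) (c q)) (a j)⟫_ℂ •
    rankOne ℂ (tmul (e j) (c q)) (tmul (e i) (c p))

/-- A product state shows `ψ` only one positive operator, the finite matrix of `ω`; hence positivity
of `ψ` suffices and complete positivity is not needed. -/
lemma prodFunctional_testOp_nonneg {σ : StrongDual ℂ (Bdd K)} {ω : StrongDual ℂ (Bdd H)}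
    (hσ : IsState σ) (hω : IsState ω) (ψ : Bdd H →ₚ[ℂ] Bdd K) {n : ℕ} (e a : Fin n → K)
    {κ : Type*} (c : κ → H) (t : Finset κ) :
    0 ≤ prodFunctional σ ω (testOp ψ e a c t) := by
  refine hσ.1 _ ?_
  have key : slice ω (testOp ψ e a c t) = ∑ i, ∑ j,
      ⟪a i, ψ (∑ p ∈ t, ∑ q ∈ t, ω (rankOne ℂ (c q) (c p)) • rankOne ℂ (c p) (c q)) (a j)⟫_ℂ •
        rankOne ℂ (e j) (e i) := by
    simp only [testOp, map_sum, map_smul, slice_rankOne, sum_apply, smul_apply, inner_sum,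
      inner_smul_right, Finset.sum_smul, smul_smul]
    simp only [mul_comm]
  refine le_of_le_of_eq ?_ key.symm
  exact sum_inner_smul_rankOne_nonneg e a (ψ.map_nonneg (sum_state_smul_rankOne_nonneg hω c t))

omit [CompleteSpace K] in
lemma IsDensityOperator.apply_testOp {ρ : StrongDual ℂ (Bdd (HTensor K H))}
    {h : Bdd (HTensor K H)} (hh : IsDensityOperator ρ h) (ψ : Bdd H →ₚ[ℂ] Bdd K) {n : ℕ}
    (e a : Fin n → K) {κ : Type*} (c : κ → H) (t : Finset κ) :
    ρ (testOp ψ e a c t) =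
      ∑ i, ∑ j, ⟪a i, ψ (finProj c t * block h (e i) (e j) * finProj c t) (a j)⟫_ℂ := by
  simp only [testOp, map_sum, map_smul, hh.apply_rankOne, finProj_mul_mul_finProj, sum_apply,
    smul_apply, inner_sum, inner_smul_right, inner_block, smul_eq_mul]
  simp only [mul_comm]

omit [CompleteSpace K] in
/-- A normal map is the pointwise weak limit of its compressions. -/
lemma IsNormalMap.tendsto_inner_finProj {ψ : Bdd H →ₚ[ℂ] Bdd K} (hψ : IsNormalMap ψ)
    {κ : Type*} (c : HilbertBasis κ ℂ H) (x : Bdd H) (u v : K) :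
    Tendsto (fun t => ⟪u, ψ (finProj c t * x * finProj c t) v⟫_ℂ) atTop (𝓝 ⟪u, ψ x v⟫_ℂ) := by
  -- Normality is continuity on bounded sets only, so the compressions must stay in one ball.
  have hb : ∀ t, ‖finProj c t * x * finProj c t‖ ≤ ‖x‖ := fun t => by
    have h1 := (isStarProjection_finProj c.orthonormal t).norm_le
    calc _ ≤ ‖finProj c t‖ * ‖x‖ * ‖finProj c t‖ := norm_mul₃_le
      _ ≤ 1 * ‖x‖ * 1 := by gcongr
      _ = ‖x‖ := by ring
  have h2 := hψ (Metric.closedBall 0 ‖x‖) Metric.isBounded_closedBall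
    (ContinuousLinearMapWOT.ofCLM x) (by simp)
  have h3 : Tendsto (fun t => ContinuousLinearMapWOT.ofCLM (finProj c t * x * finProj c t)) atTop
      (𝓝[{T : H →WOT[ℂ] H | T.toCLM ∈ Metric.closedBall 0 ‖x‖}]
        (ContinuousLinearMapWOT.ofCLM x)) :=
    tendsto_nhdsWithin_of_tendsto_nhds_of_eventually_within _
      (tendsto_finProj_mul_mul_finProj c x) (Eventually.of_forall fun t => by simpa using hb t)
  have h4 := (h2.tendsto.comp h3)
  rw [ContinuousLinearMapWOT.tendsto_iff_forall_dual_apply_tendsto] at h4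
  exact h4 v (innerSL ℂ u)

lemma isAmpliation_inner_sum {ψ : Bdd H →ₚ[ℂ] Bdd K} {h : Bdd (HTensor K H)}
    {T : Bdd (HTensor K K)} (hT : IsAmpliation ψ h T) {ι : Type*} (s : Finset ι) (e a : ι → K) :
    ⟪∑ i ∈ s, tmul (e i) (a i), T (∑ i ∈ s, tmul (e i) (a i))⟫_ℂ =
      ∑ i ∈ s, ∑ j ∈ s, ⟪a i, ψ (block h (e i) (e j)) (a j)⟫_ℂ := by
  simp only [map_sum, inner_sum, sum_inner, ← inner_block, hT _ _]
  exact Finset.sum_comm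

theorem IsSeparable.ampliation_nonneg {ρ : StrongDual ℂ (Bdd (HTensor K H))}
    {h : Bdd (HTensor K H)} (hs : IsSeparable ρ) (hh : IsDensityOperator ρ h)
    {ψ : Bdd H →ₚ[ℂ] Bdd K} (hψ : IsNormalMap ψ) : 0 ≤ ampliation ψ h := by
  have hT := isAmpliation_ampliation ψ hh.1 hh.2.1
  obtain ⟨w, c, -⟩ := exists_hilbertBasis ℂ H
  refine nonneg_of_inner_nonneg fun y => ?_
  induction y using UniformSpace.Completion.induction_on with
  -- Nonnegativity of the quadratic form is a closed condition, so algebraic tensors suffice.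
  | hp => exact isClosed_le continuous_const (by fun_prop)
  | ih y =>
    obtain ⟨n, e, a, -, rfl⟩ := exists_orthonormal_decomp y
    have hy : ((∑ i, e i ⊗ₜ[ℂ] a i : K ⊗[ℂ] K) : HTensor K K) = ∑ i, tmul (e i) (a i) :=
      map_sum (UniformSpace.Completion.toComplL (𝕜 := ℂ) (E := K ⊗[ℂ] K)) _ _
    rw [hy, isAmpliation_inner_sum hT]
    have hlim := tendsto_finsetSum Finset.univ fun i _ => tendsto_finsetSum Finset.univ fun j _ =>
      hψ.tendsto_inner_finProj c (block h (e i) (e j)) (a i) (a j)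
    -- At each finite stage `t` the double sum is the value of `ρ` on a finite rank operator, where
    -- separability applies.
    refine ge_of_tendsto' hlim fun t => ?_
    rw [← hh.apply_testOp]
    refine hs.apply_nonneg ?_
    rintro _ ⟨σ, ω, hσ, hω, -, rfl⟩
    exact prodFunctional_testOp_nonneg hσ hω ψ e a c t

end necessity

/-! ### Positivity of all ampliations implies separability. -/

section sufficiency

variable {K : Type*} [NormedAddCommGroup K] [InnerProductSpace ℂ K] [CompleteSpace K]
  {H : Type*} [NormedAddCommGroup H] [InnerProductSpace ℂ H] [CompleteSpace H]

variable (K H) in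
/-- The convex cone of the finite sums `∑ᵢ cᵢ (σᵢ ⊗ ωᵢ)`. -/
def separableCone : Set (StrongDual ℂ (Bdd (HTensor K H))) :=
  {τ | ∃ (n : ℕ) (c : Fin n → ℝ) (p : Fin n → StrongDual ℂ (Bdd (HTensor K H))),
    (∀ i, 0 ≤ c i) ∧ (∀ i, p i ∈ productStates K H) ∧ τ = ∑ i, (c i : ℂ) • p i}

lemma zero_mem_separableCone : 0 ∈ separableCone K H :=
  ⟨0, Fin.elim0, Fin.elim0, fun i => i.elim0, fun i => i.elim0, by simp⟩

lemma smul_mem_separableCone {τ : StrongDual ℂ (Bdd (HTensor K H))} (hτ : τ ∈ separableCone K H)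
    {r : ℝ} (hr : 0 ≤ r) : (r : ℂ) • τ ∈ separableCone K H := by
  obtain ⟨n, c, p, hc, hp, rfl⟩ := hτ
  exact ⟨n, fun i => r * c i, p, fun i => mul_nonneg hr (hc i), hp, by
    simp [Finset.smul_sum, smul_smul]⟩

lemma add_mem_separableCone {τ τ' : StrongDual ℂ (Bdd (HTensor K H))}
    (hτ : τ ∈ separableCone K H) (hτ' : τ' ∈ separableCone K H) :
    τ + τ' ∈ separableCone K H := by
  obtain ⟨n, c, p, hc, hp, rfl⟩ := hτ
  obtain ⟨m, d, q, hd, hq, rfl⟩ := hτ'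
  refine ⟨n + m, Fin.append c d, Fin.append p q, fun i => ?_, fun i => ?_, ?_⟩
  · refine Fin.addCases (fun i => ?_) (fun i => ?_) i
    · simpa using hc i
    · simpa using hd i
  · refine Fin.addCases (fun i => ?_) (fun i => ?_) i
    · simpa using hp i
    · simpa using hq i
  · simp [Fin.sum_univ_add]

lemma convex_separableCone : Convex ℝ (separableCone K H) := by
  intro τ hτ τ' hτ' r r' hr hr' _
  change (r : ℂ) • τ + (r' : ℂ) • τ' ∈ separableCone K H
  exact add_mem_separableCone (smul_mem_separableCone hτ hr) (smul_mem_separableCone hτ' hr')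

/-- These are the only members of the cone at which the separating functional is later tested.
Normalizing both vectors gives a product of vector states with weight `‖k‖² ‖x‖²`; zero vectors give
the empty sum. -/
lemma vecFun_tmul_mem_separableCone (k : K) (x : H) :
    vecFun (tmul k x) (tmul k x) ∈ separableCone K H := by
  by_cases hk : k = 0
  · convert zero_mem_separableCone (K := K) (H := H)
    ext T
    have : tmul k x = 0 := by rw [← norm_eq_zero]; simp [hk]
    simp [this]
  by_cases hx : x = 0
  · convert zero_mem_separableCone (K := K) (H := H)
    ext T
    simp [hx]
  have hk' : ‖k‖ ≠ 0 := norm_ne_zero_iff.mpr hk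
  have hx' : ‖x‖ ≠ 0 := norm_ne_zero_iff.mpr hx
  set k₀ : K := (‖k‖⁻¹ : ℂ) • k with hk₀
  set x₀ : H := (‖x‖⁻¹ : ℂ) • x with hx₀
  have h1 : ‖k₀‖ = 1 := by simp [hk₀, norm_smul, hk]
  have h2 : ‖x₀‖ = 1 := by simp [hx₀, norm_smul, hx]
  refine ⟨1, fun _ => ‖k‖ ^ 2 * ‖x‖ ^ 2, fun _ => prodFunctional (vecFun k₀ k₀) (vecFun x₀ x₀),
    fun _ => by positivity, fun _ => ⟨_, _, isState_vecFun h1, isState_vecFun h2,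
      isNormalFunctional_vecFun _ _, rfl⟩, ?_⟩
  ext T
  have h3 : tmul k₀ x₀ = (‖k‖⁻¹ * ‖x‖⁻¹ : ℂ) • tmul k x := by
    simp only [tmul, hk₀, hx₀, leg_smul, smul_apply, map_smul, smul_smul, mul_comm]
    push_cast
    rfl
  have hk'' : (‖k‖ : ℂ) ≠ 0 := Complex.ofReal_ne_zero.mpr hk'
  have hx'' : (‖x‖ : ℂ) ≠ 0 := Complex.ofReal_ne_zero.mpr hx'
  simp only [prodFunctional_vecFun, h3, Finset.univ_unique, Finset.sum_const, Finset.card_singleton,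
    one_smul, smul_apply, vecFun_apply, map_smul, inner_smul_left, inner_smul_right, smul_eq_mul]
  simp only [map_mul, Complex.conj_ofReal]
  push_cast
  field_simp

/-- A functional outside the closed cone of separable functionals is separated from it. -/
lemma exists_separating {ρ : StrongDual ℂ (Bdd (HTensor K H))} (hρ : ¬ IsSeparable ρ) :
    ∃ f : StrongDual ℂ (StrongDual ℂ (Bdd (HTensor K H))),
      (f ρ).re < 0 ∧ ∀ τ ∈ separableCone K H, 0 ≤ (f τ).re := by
  obtain ⟨f, u, hfu, hf⟩ := RCLike.geometric_hahn_banach_point_closed (𝕜 := ℂ)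
    (convex_separableCone (K := K) (H := H)).closure isClosed_closure hρ
  have hu : u < 0 := by
    simpa using hf 0 (subset_closure zero_mem_separableCone)
  refine ⟨f, hfu.trans hu, fun τ hτ => ?_⟩
  by_contra! hneg
  -- Rescaling `τ` by `u / Re f τ ≥ 0` stays in the cone and makes `Re f` equal to `u`, against the
  -- strict bound `u < Re f`.
  have h1 := hf _ (subset_closure (smul_mem_separableCone hτ
    (r := u / (f τ).re) (div_nonneg_of_nonpos hu.le hneg.le)))
  rw [map_smul, smul_eq_mul] at h1
  change u < ((u / (f τ).re : ℝ) * f τ : ℂ).re at h1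
  rw [Complex.re_ofReal_mul, div_mul_cancel₀ _ hneg.ne] at h1
  exact lt_irrefl _ h1

/-- The hermitian sesquilinear form `(u, v) ↦ f (ω_{u,v}) + conj (f (ω_{v,u}))`. -/
noncomputable def hermForm {E : Type*} [NormedAddCommGroup E] [InnerProductSpace ℂ E]
    (f : StrongDual ℂ (StrongDual ℂ (Bdd E))) : E →ₗ⋆[ℂ] E →ₗ[ℂ] ℂ :=
  have hadd₁ (u u' v : E) : vecFun (u + u') v = vecFun u v + vecFun u' v := by
    ext; simp
  have hadd₂ (u v v' : E) : vecFun u (v + v') = vecFun u v + vecFun u v' := by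
    ext; simp
  have hsmul₁ (c : ℂ) (u v : E) : vecFun (c • u) v = star c • vecFun u v := by
    ext; simp [mul_comm]
  have hsmul₂ (c : ℂ) (u v : E) : vecFun u (c • v) = c • vecFun u v := by
    ext; simp
  LinearMap.mk₂'ₛₗ _ _ (fun u v => f (vecFun u v) + star (f (vecFun v u)))
    (fun u u' v => by simp only [hadd₁, hadd₂, map_add, star_add]; ring)
    (fun c u v => by
      simp only [hsmul₁, hsmul₂, map_smul, smul_eq_mul, star_mul', starRingEnd_apply]; ring)
    (fun u v v' => by simp only [hadd₁, hadd₂, map_add, star_add]; ring)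
    (fun c u v => by
      simp only [hsmul₁, hsmul₂, map_smul, smul_eq_mul, star_mul', star_star, RingHom.id_apply]
      ring)

lemma hermForm_apply {E : Type*} [NormedAddCommGroup E] [InnerProductSpace ℂ E]
    (f : StrongDual ℂ (StrongDual ℂ (Bdd E))) (u v : E) :
    hermForm f u v = f (vecFun u v) + star (f (vecFun v u)) := rfl

/-- Separation controls only the real part of `f`. Adding the conjugate makes the diagonal of the
form equal to `2 Re f`, hence real. -/
lemma hermForm_self_nonneg {E : Type*} [NormedAddCommGroup E] [InnerProductSpace ℂ E]
    {f : StrongDual ℂ (StrongDual ℂ (Bdd E))} {u : E} (hu : 0 ≤ (f (vecFun u u)).re) :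
    0 ≤ hermForm f u u := by
  rw [hermForm_apply, Complex.star_def, Complex.add_conj]
  exact_mod_cast mul_nonneg zero_le_two hu

/-- The linear map with `⟪b_j, φ(x) b_i⟫ = ∑ g (bᵢ ⊗ cₚ, b_j ⊗ c_q) ⟪c_q, x cₚ⟫`. -/
noncomputable def choiMap {ι κ : Type*} (g : HTensor K H →ₗ⋆[ℂ] HTensor K H →ₗ[ℂ] ℂ)
    (b : ι → K) (c : κ → H) (s : Finset ι) (t : Finset κ) : Bdd H →ₗ[ℂ] Bdd K :=
  ∑ α ∈ s ×ˢ t, ∑ β ∈ s ×ˢ t,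
    (g (tmul (b α.1) (c α.2)) (tmul (b β.1) (c β.2)) •
      (vecFun (c β.2) (c α.2)).toLinearMap).smulRight (rankOne ℂ (b β.1) (b α.1))

omit [CompleteSpace K] [CompleteSpace H] in
lemma inner_choiMap {ι κ : Type*} (g : HTensor K H →ₗ⋆[ℂ] HTensor K H →ₗ[ℂ] ℂ)
    (b : ι → K) (c : κ → H) (s : Finset ι) (t : Finset κ) (x : Bdd H) (u v : K) :
    ⟪u, choiMap g b c s t x v⟫_ℂ = ∑ α ∈ s ×ˢ t, ∑ β ∈ s ×ˢ t,
      g (tmul (b α.1) (c α.2)) (tmul (b β.1) (c β.2)) * ⟪c β.2, x (c α.2)⟫_ℂ *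
        (⟪u, b β.1⟫_ℂ * ⟪b α.1, v⟫_ℂ) := by
  simp only [choiMap, LinearMap.sum_apply, LinearMap.smulRight_apply, LinearMap.smul_apply,
    ContinuousLinearMap.coe_coe, vecFun_apply, sum_apply, smul_apply, rankOne_apply, inner_sum,
    inner_smul_right, smul_eq_mul]
  exact Finset.sum_congr rfl fun i _ => Finset.sum_congr rfl fun j _ => by ring

variable (K H) in
/-- `k ↦ V_k` as a linear map. -/
noncomputable def legₗ : K →ₗ[ℂ] H →L[ℂ] HTensor K H where
  toFun := leg H
  map_add' := leg_add
  map_smul' := leg_smul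

omit [CompleteSpace K] [CompleteSpace H] in
lemma legₗ_apply (k : K) : legₗ K H k = leg H k := rfl

/-- Writing `x = S²` and expanding in a basis `d` splits the quadratic form at `v` into a series
whose `r`-th term is `g` at a single product vector, taken twice. -/
lemma choiMap_nonneg {ι κ : Type*} {g : HTensor K H →ₗ⋆[ℂ] HTensor K H →ₗ[ℂ] ℂ}
    (hg : ∀ k x, 0 ≤ g (tmul k x) (tmul k x)) (b : ι → K) (c : κ → H) (s : Finset ι)
    (t : Finset κ) {x : Bdd H} (hx : 0 ≤ x) : 0 ≤ choiMap g b c s t x := by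
  refine nonneg_of_inner_nonneg fun v => ?_
  rw [inner_choiMap]
  obtain ⟨S, hS, rfl⟩ := exists_sqrt hx
  obtain ⟨w, d, -⟩ := exists_hilbertBasis ℂ H
  have hin : ∀ p q, ⟪p, (S ∘L S) q⟫_ℂ = ⟪S p, S q⟫_ℂ := fun p q => by
    rw [← ContinuousLinearMap.adjoint_inner_right, hS.adjoint_eq]
    rfl
  have hsum := hasSum_sum fun α (_ : α ∈ s ×ˢ t) => hasSum_sum fun β (_ : β ∈ s ×ˢ t) =>
    ((d.hasSum_inner_mul_inner (S (c β.2)) (S (c α.2))).mul_left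
      (g (tmul (b α.1) (c α.2)) (tmul (b β.1) (c β.2)))).mul_right
        (⟪v, b β.1⟫_ℂ * ⟪b α.1, v⟫_ℂ)
  simp only [hin]
  refine hsum.nonneg fun r => ?_
  -- The coordinates of `k` and `z` are the complex conjugates of those of `v` and `S (d r)`,
  -- because `g` is conjugate linear in its first argument.
  let k : K := ∑ j ∈ s, ⟪v, b j⟫_ℂ • b j
  let z : H := ∑ q ∈ t, ⟪S (c q), d r⟫_ℂ • c q
  have hkz : tmul k z =
      ∑ β ∈ s ×ˢ t, (⟪v, b β.1⟫_ℂ * ⟪S (c β.2), d r⟫_ℂ) • tmul (b β.1) (c β.2) := by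
    have hleg : leg H k = ∑ j ∈ s, ⟪v, b j⟫_ℂ • leg H (b j) := by
      rw [← legₗ_apply]
      simp only [k, map_sum, map_smul, legₗ_apply]
    rw [Finset.sum_product_right]
    simp only [tmul, hleg, z, sum_apply, smul_apply, map_sum, map_smul, Finset.smul_sum, smul_smul,
      mul_comm]
  have key := hg k z
  rw [hkz] at key
  simp only [map_sum, LinearMap.sum_apply, map_smulₛₗ, LinearMap.smul_apply, map_mul,
    inner_conj_symm, smul_eq_mul, RingHom.id_apply, Finset.mul_sum] at key
  rw [Finset.sum_comm] at key
  exact key.trans_eq (Finset.sum_congr rfl fun α _ => Finset.sum_congr rfl fun β _ => by ring)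

/-- `choiMap` as a positive linear map. -/
noncomputable def positiveChoiMap {ι κ : Type*} {g : HTensor K H →ₗ⋆[ℂ] HTensor K H →ₗ[ℂ] ℂ}
    (hg : ∀ k x, 0 ≤ g (tmul k x) (tmul k x)) (b : ι → K) (c : κ → H) (s : Finset ι)
    (t : Finset κ) : Bdd H →ₚ[ℂ] Bdd K :=
  PositiveLinearMap.mk₀ (choiMap g b c s t) fun _ => choiMap_nonneg hg b c s t

/-- Only finitely many matrix entries of the argument enter, and each is continuous in the weak
operator topology. -/
lemma isNormalMap_positiveChoiMap {ι κ : Type*}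
    {g : HTensor K H →ₗ⋆[ℂ] HTensor K H →ₗ[ℂ] ℂ}
    (hg : ∀ k x, 0 ≤ g (tmul k x) (tmul k x)) (b : ι → K) (c : κ → H) (s : Finset ι)
    (t : Finset κ) : IsNormalMap (positiveChoiMap hg b c s t) := by
  intro _ _
  refine Continuous.continuousOn
    (ContinuousLinearMapWOT.continuous_of_dual_apply_continuous fun v y => ?_)
  obtain ⟨u, rfl⟩ := (toDual ℂ K).surjective y
  change Continuous fun T : H →WOT[ℂ] H => ⟪u, choiMap g b c s t T.toCLM v⟫_ℂ
  simp only [inner_choiMap]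
  refine continuous_finsetSum _ fun α _ => continuous_finsetSum _ fun β _ => ?_
  exact (continuous_const.mul (ContinuousLinearMapWOT.continuous_dual_apply (c α.2)
    (innerSL ℂ (c β.2)))).mul continuous_const

omit [CompleteSpace K] in
/-- The value of `(ι ⊗ φ)(h)` at the vector `∑ⱼ bⱼ ⊗ bⱼ`, for `φ = choiMap g b c s t`. -/
lemma sum_inner_choiMap_block {ι κ : Type*} (g : HTensor K H →ₗ⋆[ℂ] HTensor K H →ₗ[ℂ] ℂ)
    {b : ι → K} (hb : Orthonormal ℂ b) (c : κ → H) (s : Finset ι) (t : Finset κ)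
    (h : Bdd (HTensor K H)) :
    ∑ i ∈ s, ∑ j ∈ s, ⟪b i, choiMap g b c s t (block h (b i) (b j)) (b j)⟫_ℂ =
      ∑ α ∈ s ×ˢ t, ∑ β ∈ s ×ˢ t, g (tmul (b α.1) (c α.2)) (tmul (b β.1) (c β.2)) *
        ⟪tmul (b β.1) (c β.2), h (tmul (b α.1) (c α.2))⟫_ℂ := by
  classical
  simp only [inner_choiMap, inner_block, orthonormal_iff_ite.mp hb]
  have hswap : ∀ F : ι → ι → ι × κ → ι × κ → ℂ,
      ∑ i ∈ s, ∑ j ∈ s, ∑ α ∈ s ×ˢ t, ∑ β ∈ s ×ˢ t, F i j α β =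
        ∑ α ∈ s ×ˢ t, ∑ β ∈ s ×ˢ t, ∑ i ∈ s, ∑ j ∈ s, F i j α β := fun F => by
    calc _ = ∑ i ∈ s, ∑ α ∈ s ×ˢ t, ∑ j ∈ s, ∑ β ∈ s ×ˢ t, F i j α β :=
          Finset.sum_congr rfl fun i _ => Finset.sum_comm
      _ = ∑ α ∈ s ×ˢ t, ∑ i ∈ s, ∑ j ∈ s, ∑ β ∈ s ×ˢ t, F i j α β := Finset.sum_comm
      _ = ∑ α ∈ s ×ˢ t, ∑ i ∈ s, ∑ β ∈ s ×ˢ t, ∑ j ∈ s, F i j α β :=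
          Finset.sum_congr rfl fun α _ => Finset.sum_congr rfl fun i _ => Finset.sum_comm
      _ = _ := Finset.sum_congr rfl fun α _ => Finset.sum_comm
  rw [hswap]
  refine Finset.sum_congr rfl fun α hα => Finset.sum_congr rfl fun β hβ => ?_
  have hα' := (Finset.mem_product.mp hα).1
  have hβ' := (Finset.mem_product.mp hβ).1
  -- Orthonormality leaves only `i = β.1` and `j = α.1`.
  rw [Finset.sum_eq_single_of_mem _ hβ', Finset.sum_eq_single_of_mem _ hα']
  · simp
  · intro j _ hj
    simp [hj.symm]
  · intro i _ hi
    simp [hi]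

/-- Pairing the hermitian form of `f` with the matrix of `ρ` gives `2 Re f` of the compression. -/
lemma sum_hermForm_mul {E : Type*} [NormedAddCommGroup E] [InnerProductSpace ℂ E]
    [CompleteSpace E] {ρ : StrongDual ℂ (Bdd E)} (hρ : IsState ρ)
    (f : StrongDual ℂ (StrongDual ℂ (Bdd E))) {ι : Type*} (b : ι → E) (s : Finset ι) :
    ∑ i ∈ s, ∑ j ∈ s, hermForm f (b i) (b j) * ρ (rankOne ℂ (b i) (b j)) =
      ((2 * (f (compress ρ b s)).re : ℝ) : ℂ) := by
  -- The matrix of a state is hermitian, so the conjugated half of `hermForm` contributes the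
  -- conjugate of the first half.
  have hstar : ∀ i j, star (ρ (rankOne ℂ (b i) (b j))) = ρ (rankOne ℂ (b j) (b i)) := fun i j => by
    rw [← hρ.map_star, ContinuousLinearMap.star_eq_adjoint, adjoint_rankOne]
  rw [← Complex.add_conj, ← Complex.star_def]
  simp only [compress, map_sum, map_smul, smul_eq_mul, star_sum, star_mul', hstar, hermForm_apply,
    add_mul, Finset.sum_add_distrib]
  congr 1
  · simp only [mul_comm]
  · rw [Finset.sum_comm]
    simp only [mul_comm]

theorem isSeparable_of_ampliation_nonneg {ρ : StrongDual ℂ (Bdd (HTensor K H))}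
    {h : Bdd (HTensor K H)} (hρ : IsState ρ) (hh : IsDensityOperator ρ h)
    (hψ : ∀ ψ : Bdd H →ₚ[ℂ] Bdd K, IsNormalMap ψ → 0 ≤ ampliation ψ h) : IsSeparable ρ := by
  classical
  by_contra hsep
  obtain ⟨f, hf, hpos⟩ := exists_separating hsep
  obtain ⟨v, b, -⟩ := exists_hilbertBasis ℂ K
  obtain ⟨w, c, -⟩ := exists_hilbertBasis ℂ H
  -- Rectangles `s ×ˢ t` are cofinal among the finite sets of index pairs, so the compressions may
  -- be taken to product blocks, as `choiMap` requires.
  have hlim : Tendsto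
      (fun p : Finset v × Finset w => (f (compress ρ (prodBasis b c) (p.1 ×ˢ p.2))).re) atTop
      (𝓝 (f ρ).re) :=
    ((Complex.continuous_re.comp f.continuous).tendsto ρ).comp
      ((tendsto_compress hρ hh (prodBasis b c)).comp tendsto_finsetProd_atTop)
  obtain ⟨⟨s, t⟩, hst⟩ := (hlim.eventually_lt_const hf).exists
  have hg : ∀ k x, 0 ≤ hermForm f (tmul k x) (tmul k x) := fun k x =>
    hermForm_self_nonneg (hpos _ (vecFun_tmul_mem_separableCone k x))
  let ψ := positiveChoiMap hg b c s t
  have hT := isAmpliation_ampliation ψ hh.1 hh.2.1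
  -- The unnormalized maximally entangled vector recovers the full pairing of the Choi matrix with
  -- the block of `h`.
  have h0 := inner_nonneg_of_nonneg (hψ ψ (isNormalMap_positiveChoiMap hg b c s t))
    (∑ i ∈ s, tmul (b i) (b i))
  rw [isAmpliation_inner_sum hT] at h0
  have h1 := sum_inner_choiMap_block (hermForm f) b.orthonormal c s t h
  have h2 := sum_hermForm_mul hρ f (prodBasis b c) (s ×ˢ t)
  simp only [hh.apply_rankOne, prodBasis_apply] at h2
  rw [← h1] at h2
  have h3 : (0 : ℂ) ≤ ((2 * (f (compress ρ (prodBasis b c) (s ×ˢ t))).re : ℝ) : ℂ) :=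
    h0.trans_eq h2
  rw [Complex.zero_le_real] at h3
  linarith

end sufficiency

end NormalStates

theorem mainTheorem4
    {K : Type*} [NormedAddCommGroup K] [InnerProductSpace ℂ K] [CompleteSpace K]
    {H : Type*} [NormedAddCommGroup H] [InnerProductSpace ℂ H] [CompleteSpace H]
    (ρ : StrongDual ℂ (NormalStates.Bdd (NormalStates.HTensor K H)))
    (h : NormalStates.Bdd (NormalStates.HTensor K H))
    (hρ : NormalStates.IsState ρ) (hρn : NormalStates.IsNormalFunctional ρ)
    (hh : NormalStates.IsDensityOperator ρ h) :
    NormalStates.IsSeparable ρ ↔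
      ∀ ψ : NormalStates.Bdd H →ₚ[ℂ] NormalStates.Bdd K,
        NormalStates.IsNormalMap ψ → 0 ≤ NormalStates.ampliation ψ h :=
  ⟨fun hs _ hψ => hs.ampliation_nonneg hh hψ,
    NormalStates.isSeparable_of_ampliation_nonneg hρ hh⟩
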